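/- Let $P\subset\mathbb R^d$ be a convex polytope, i.e. the convex hull of a finite set not contained in any affine hyperplane, and let $\mathcal V$ be its set of vertices, i.e. the inclusion-minimal finite set whose convex hull is $P$. Let $\rho$ be a homogeneous polynomial of degree $\delta\ge 0$ in $d$ variables with real or complex coefficients. Define the normalized moment generating function of $P$ with density $\rho$ by $$F_P^\rho(\mathbf u)=\sum_{I=(i_1,\dots,i_d)\ge 0}\frac{(|I|+d+\delta)!}{i_1!\cdots i_d!}\left(\int_P \mathbf x^I\rho(\mathbf x)\,d\mathbf x\right)\mathbf u^I ,\qquad |I|=i_1+\dots+i_d .$$ Then $F_P^\rho(\mathbf u)$ is a rational function whose denominator divides $$\prod_{\mathbf v\in\mathcal V}\bigl(1-\langle \mathbf v,\mathbf u\rangle\bigr)^{\delta+1}.$$ That is, there are coprime polynomials $p,q$ in $\mathbf u=(u_1,\dots,u_d)$, with coefficients in the same field as those of $\rho$, such that $q$ divides this product, $q\,F_P^\rho=p$ as formal power series, and, for all $\mathbf u$ in a neighbourhood of the origin, $q(\mathbf u)\neq0$ and the series converges absolutely to $p(\mathbf u)/q(\mathbf u)$. -/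

import Mathlib

open MeasureTheory Filter Topology

namespace PolytopeMoments

noncomputable section

/-- A (compact, convex) polytope in `ℝ^d`: the convex hull of a finite spanning set, i.e. of a
finite set that lies in no proper affine subspace. -/
def IsConvexPolytope {d : ℕ} (P : Set (EuclideanSpace ℝ (Fin d))) : Prop :=
  ∃ S : Finset (EuclideanSpace ℝ (Fin d)),
    affineSpan ℝ (S : Set (EuclideanSpace ℝ (Fin d))) = ⊤ ∧
      P = convexHull ℝ (S : Set (EuclideanSpace ℝ (Fin d)))

/-- `V` is the vertex set of `P`: the inclusion-minimal finite set with convex hull `P`. -/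
def IsVertexSet {d : ℕ} (P : Set (EuclideanSpace ℝ (Fin d)))
    (V : Finset (EuclideanSpace ℝ (Fin d))) : Prop :=
  Minimal (fun T : Finset (EuclideanSpace ℝ (Fin d)) =>
    convexHull ℝ (T : Set (EuclideanSpace ℝ (Fin d))) = P) V

/-- The standard measure of `Ω`: Lebesgue measure restricted to `Ω`. -/
def standardMeasure {d : ℕ} (Ω : Set (EuclideanSpace ℝ (Fin d))) :
    Measure (EuclideanSpace ℝ (Fin d)) :=
  volume.restrict Ω

/-- The moment `m_I(ρμ) = ∫ x^I ρ(x) dμ(x)`. -/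
def moment {𝕜 : Type*} [RCLike 𝕜] {d : ℕ} (ρ : MvPolynomial (Fin d) 𝕜)
    (μ : Measure (EuclideanSpace ℝ (Fin d))) (I : Fin d →₀ ℕ) : 𝕜 :=
  ∫ x, (∏ i, ((x i : ℝ) : 𝕜) ^ I i) * MvPolynomial.eval (fun i => ((x i : ℝ) : 𝕜)) ρ ∂μ

/-- The normalized moment generating function
`F_μ^ρ(u) = ∑_I (|I| + d + δ)! / (i₁! ⋯ i_d!) * m_I(ρμ) * u^I`, as a formal power series. -/
def momentGenFun {𝕜 : Type*} [RCLike 𝕜] {d : ℕ} (δ : ℕ) (ρ : MvPolynomial (Fin d) 𝕜)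
    (μ : Measure (EuclideanSpace ℝ (Fin d))) : MvPowerSeries (Fin d) 𝕜 :=
  fun I => ((Nat.factorial ((∑ i, I i) + d + δ) : 𝕜) / ∏ i, (Nat.factorial (I i) : 𝕜)) *
    moment ρ μ I

/-- The polynomial `1 - ⟨v, u⟩` in the variables `u`. -/
def dualForm (𝕜 : Type*) [RCLike 𝕜] {d : ℕ} (v : EuclideanSpace ℝ (Fin d)) :
    MvPolynomial (Fin d) 𝕜 :=
  1 - ∑ i, MvPolynomial.C ((v i : ℝ) : 𝕜) * MvPolynomial.X i

end

end PolytopeMoments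

/-!
The generating function is additive in the polytope, so it suffices to cut the polytope into
simplices with vertices in `V` and to treat a single simplex.

*Triangulation.* Lift the points of `V` to generic heights. A point `x` of the convex hull has a
representation as a convex combination of `V` of least total height; for `x` outside finitely many
proper affine subspaces its support spans a simplex, which is a cell of the lower hull
(`exists_isLowerCell_of_generic`), and no other cell contains `x`
(`IsLowerCell.subset_of_mem_of_mem`). Hence integrals over the polytope are sums of integrals over
simplices without new vertices (`exists_triangulation`).

*Simplices.* For a homogeneous integrand `h` of degree `n`, the number `(n + d)! ∫_Δ h` is the
integral of `e^{-r} h(y)` over the cone `{(r, y) | y ∈ r • Δ}`. The vectors `(1, v j)` identify this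
cone linearly with an orthant, and there the integrals of monomials are products of factorials
(`exists_factorial_smul_integral_simplex`). Writing the density in barycentric coordinates as
`∑ α, r α • s ^ α` with `|α| = δ`, the generating function becomes, up to a constant,
`∑ α, r α ∏ j, α j ! / (1 - ⟨v j, u⟩) ^ (α j + 1)`, in which `α j ≤ δ`
(`exists_dualForm_mul_momentGenFun_simplex`).

*Convergence.* The moments grow at most geometrically, and the factorials are controlled by
multinomial coefficients, so the series converges absolutely near the origin
(`eventually_summable_norm_momentGenFun`). The Cauchy product turns the formal identity `q F = p`
into an identity of functions (`hasSum_div_of_coe_mul_eq_coe`). The reduced fraction `p / q` comes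
from unique factorization, and `q` does not vanish near `0` because it divides a polynomial with
value `1` there.
-/

namespace PolytopeMoments

/-! ### Triangulating a convex hull without new vertices -/

section Triangulation

variable {E : Type*} [NormedAddCommGroup E] [NormedSpace ℝ E]

/-- `c` is an affine dependence between the points of `V`, extended by zero outside `V`. -/
structure IsAffineRelation (V : Finset E) (c : E → ℝ) : Prop where
  eq_zero : ∀ v ∉ V, c v = 0
  sum_eq_zero : ∑ v ∈ V, c v = 0
  sum_smul_eq_zero : ∑ v ∈ V, c v • v = 0

/-- The height function `w` is generic on `V`: on every affinely dependent subset of `V` it is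
detected by some affine dependence. -/
def IsGenericHeight (V : Finset E) (w : E → ℝ) : Prop :=
  ∀ τ ⊆ V, ¬ AffineIndependent ℝ ((↑) : τ → E) →
    ∃ c, IsAffineRelation V c ∧ (∀ v ∉ τ, c v = 0) ∧ ∑ v ∈ V, c v * w v ≠ 0

/-- `σ` is a maximal cell of the regular subdivision of `V` induced by the heights `w`: it spans a
simplex, and the affine function `ℓ` interpolating `w` on `σ` lies strictly below `w` on the rest
of `V`. -/
structure IsLowerCell (V : Finset E) (w : E → ℝ) (σ : Finset E) : Prop where
  subset : σ ⊆ V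
  independent : AffineIndependent ℝ ((↑) : σ → E)
  span_eq_top : affineSpan ℝ (σ : Set E) = ⊤
  exists_affine : ∃ ℓ : E →ᵃ[ℝ] ℝ, (∀ v ∈ σ, ℓ v = w v) ∧ ∀ v ∈ V, v ∉ σ → ℓ v < w v

lemma exists_isGenericHeight (V : Finset E) : ∃ w : E → ℝ, IsGenericHeight V w := by
  classical
  have key : ∀ τ : Finset E, ∃ H : Submodule ℝ (E → ℝ), H ≠ ⊤ ∧ (τ ⊆ V →
      ¬ AffineIndependent ℝ ((↑) : τ → E) → ∀ w ∉ H, ∃ c, IsAffineRelation V c ∧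
        (∀ v ∉ τ, c v = 0) ∧ ∑ v ∈ V, c v * w v ≠ 0) := by
    intro τ
    by_cases h : τ ⊆ V ∧ ¬ AffineIndependent ℝ ((↑) : τ → E)
    · obtain ⟨hτ, hdep⟩ := h
      obtain ⟨f, hf1, hf0, x, hx, hfx⟩ := exists_nontrivial_relation_sum_zero_of_not_affine_ind hdep
      let c : E → ℝ := fun v => if v ∈ τ then f v else 0
      let φ : (E → ℝ) →ₗ[ℝ] ℝ := ∑ v ∈ V, c v • LinearMap.proj v
      have hφ : ∀ w, φ w = ∑ v ∈ V, c v * w v := fun w => by simp [φ]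
      refine ⟨LinearMap.ker φ, ?_, fun _ _ w hw => ⟨c, ⟨?_, ?_, ?_⟩, ?_, ?_⟩⟩
      · intro htop
        have h1 : φ (Pi.single x 1) = 0 := by
          have : (Pi.single x 1 : E → ℝ) ∈ LinearMap.ker φ := htop ▸ Submodule.mem_top
          exact this
        rw [hφ, Finset.sum_eq_single x] at h1
        · simp [c, hx, hfx] at h1
        · intro b _ hb; simp [hb]
        · intro hxV; exact absurd (hτ hx) hxV
      · intro v hv; exact if_neg fun h => hv (hτ h)
      · rw [← hf0, ← Finset.sum_subset hτ (fun v _ hv => by simp [c, hv])]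
        exact Finset.sum_congr rfl fun v hv => by simp [c, hv]
      · rw [← hf1, ← Finset.sum_subset hτ (fun v _ hv => by simp [c, hv])]
        exact Finset.sum_congr rfl fun v hv => by simp [c, hv]
      · intro v hv; simp [c, hv]
      · rw [← hφ]; exact hw
    · refine ⟨⊥, ?_, fun h1 h2 => absurd ⟨h1, h2⟩ h⟩
      intro hbot
      have : (fun _ => 1 : E → ℝ) ∈ (⊥ : Submodule ℝ (E → ℝ)) := hbot ▸ Submodule.mem_top
      rw [Submodule.mem_bot] at this
      exact one_ne_zero (congrFun this 0)
  choose H hH hgen using key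
  have hne : ⋃ p ∈ V.powerset.image H, (p : Set (E → ℝ)) ≠ Set.univ := by
    apply Subspace.biUnion_ne_univ_of_top_notMem
    simp only [Finset.mem_image, not_exists, not_and]
    exact fun τ _ => hH τ
  obtain ⟨w, hw⟩ := (Set.ne_univ_iff_exists_notMem _).1 hne
  refine ⟨w, fun τ hτ hdep => hgen τ hτ hdep w fun hmem => hw ?_⟩
  simp only [Set.mem_iUnion]
  exact ⟨H τ, Finset.mem_image_of_mem H (Finset.mem_powerset.2 hτ), hmem⟩

lemma IsAffineRelation.neg {V : Finset E} {c : E → ℝ} (hc : IsAffineRelation V c) :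
    IsAffineRelation V (-c) where
  eq_zero v hv := by simp [hc.eq_zero v hv]
  sum_eq_zero := by simp [hc.sum_eq_zero]
  sum_smul_eq_zero := by simp [hc.sum_smul_eq_zero]

lemma sum_mul_affine_apply (ℓ : E →ᵃ[ℝ] ℝ) (s : Finset E) (a : E → ℝ) :
    ∑ v ∈ s, a v * ℓ v = ℓ.linear (∑ v ∈ s, a v • v) + (∑ v ∈ s, a v) * ℓ 0 := by
  rw [map_sum, Finset.sum_mul, ← Finset.sum_add_distrib]
  refine Finset.sum_congr rfl fun v _ => ?_
  have h : ℓ v = ℓ.linear v + ℓ 0 := congrFun ℓ.decomp v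
  rw [h, map_smul, smul_eq_mul, mul_add]

lemma IsAffineRelation.sum_mul_affine {V : Finset E} {c : E → ℝ} (hc : IsAffineRelation V c)
    (ℓ : E →ᵃ[ℝ] ℝ) : ∑ v ∈ V, c v * ℓ v = 0 := by
  rw [sum_mul_affine_apply, hc.sum_eq_zero, hc.sum_smul_eq_zero, map_zero, zero_mul, add_zero]

/-- A representation of `x` as a convex combination of `V` of least total height `w`, together with
its first-order optimality condition: no admissible affine dependence decreases the height. -/
lemma exists_optimal_weights (V : Finset E) (w : E → ℝ) {x : E}
    (hx : x ∈ convexHull ℝ (V : Set E)) :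
    ∃ t : E → ℝ, (∀ v ∈ V, 0 ≤ t v) ∧ ∑ v ∈ V, t v = 1 ∧ ∑ v ∈ V, t v • v = x ∧
      ∀ c, IsAffineRelation V c → (∀ v ∈ V, t v = 0 → 0 ≤ c v) → 0 ≤ ∑ v ∈ V, c v * w v := by
  classical
  let K : Set (V → ℝ) := stdSimplex ℝ V ∩ {t | ∑ v, t v • (v : E) = x}
  have hK : IsCompact K :=
    (isCompact_stdSimplex ℝ V).inter_right (isClosed_eq (by fun_prop) continuous_const)
  obtain ⟨s, hs0, hs1, hsx⟩ := Finset.mem_convexHull'.1 hx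
  have hKne : K.Nonempty := by
    refine ⟨fun v => s v, ⟨fun v => hs0 v v.2, ?_⟩, ?_⟩
    · rw [← hs1]; exact Finset.sum_coe_sort V s
    · rw [Set.mem_ofPred_eq, ← hsx]; exact Finset.sum_coe_sort V fun v => s v • v
  obtain ⟨t₀, ⟨⟨ht0, ht1⟩, htx⟩, hmin⟩ := hK.exists_isMinOn hKne
    (f := fun t => ∑ v, t v * w v) (by fun_prop)
  let t : E → ℝ := fun v => if h : v ∈ V then t₀ ⟨v, h⟩ else 0
  have htt : ∀ v : V, t v = t₀ v := fun v => by simp [t]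
  refine ⟨t, fun v hv => ?_, ?_, ?_, fun c hc hpos => ?_⟩
  · rw [show t v = t₀ ⟨v, hv⟩ from htt ⟨v, hv⟩]; exact ht0 _
  · rw [← ht1, ← Finset.sum_coe_sort]; simp_rw [htt]
  · rw [← (show _ = x from htx), ← Finset.sum_coe_sort]; simp_rw [htt]
  -- A small step along `c` keeps all weights nonnegative, so minimality of `t` applies.
  · have hev : ∀ᶠ ε : ℝ in 𝓝[>] 0, ∀ v ∈ V, 0 ≤ t v + ε * c v := by
      rw [eventually_all_finset]
      intro v hv
      have htv : 0 ≤ t v := by rw [show t v = t₀ ⟨v, hv⟩ from htt ⟨v, hv⟩]; exact ht0 _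
      rcases htv.eq_or_lt with h0 | h0
      · filter_upwards [self_mem_nhdsWithin] with ε hε
        rw [← h0, zero_add]
        exact mul_nonneg (le_of_lt hε) (hpos v hv h0.symm)
      · have hcont : Tendsto (fun ε : ℝ => t v + ε * c v) (𝓝[>] 0) (𝓝 (t v)) := by
          have : Continuous fun ε : ℝ => t v + ε * c v := by fun_prop
          simpa using (this.tendsto 0).mono_left nhdsWithin_le_nhds
        exact (hcont.eventually (lt_mem_nhds h0)).mono fun _ h => le_of_lt h
    obtain ⟨ε, hε, hε0⟩ := (hev.and self_mem_nhdsWithin).exists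
    have hε0 : 0 < ε := hε0
    have hmem : (fun v : V => t v + ε * c v) ∈ K := by
      refine ⟨⟨fun v => hε v v.2, ?_⟩, ?_⟩
      · rw [Finset.sum_coe_sort V (fun v => t v + ε * c v), Finset.sum_add_distrib,
          ← Finset.mul_sum, hc.sum_eq_zero, mul_zero, add_zero, ← ht1, ← Finset.sum_coe_sort]
        simp_rw [htt]
      · rw [Set.mem_ofPred_eq, Finset.sum_coe_sort V (fun v => (t v + ε * c v) • v)]
        simp_rw [add_smul, Finset.sum_add_distrib, mul_smul, ← Finset.smul_sum,
          hc.sum_smul_eq_zero, smul_zero, add_zero]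
        rw [← (show _ = x from htx), ← Finset.sum_coe_sort]; simp_rw [htt]
    have h := hmin hmem
    simp only [Set.mem_ofPred_eq, htt, add_mul, Finset.sum_add_distrib, le_add_iff_nonneg_right,
      mul_assoc, ← Finset.mul_sum] at h
    rw [Finset.sum_coe_sort V (fun v => c v * w v)] at h
    exact nonneg_of_mul_nonneg_right h hε0

lemma exists_affine_interpolation {σ : Finset E} (hind : AffineIndependent ℝ ((↑) : σ → E))
    (htop : affineSpan ℝ (σ : Set E) = ⊤) (w : E → ℝ) :
    ∃ ℓ : E →ᵃ[ℝ] ℝ, ∀ v ∈ σ, ℓ v = w v := by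
  classical
  let b : AffineBasis σ ℝ E := ⟨(↑), hind, by simpa using htop⟩
  refine ⟨∑ i : σ, w i • b.coord i, fun v hv => ?_⟩
  have hb : ∀ i : σ, b.coord i v = if i = ⟨v, hv⟩ then 1 else 0 := fun i =>
    b.coord_apply i ⟨v, hv⟩
  have hsum : ∀ s : Finset σ, (∑ i ∈ s, w i • b.coord i) v = ∑ i ∈ s, w i * b.coord i v := by
    intro s
    induction s using Finset.induction_on with
    | empty => simp
    | insert a s ha ih => rw [Finset.sum_insert ha, Finset.sum_insert ha, ← ih]; rfl
  rw [hsum]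
  simp [hb]

/-- Points outside all proper affine subspaces spanned by subsets of `V` lie in some cell. -/
lemma exists_isLowerCell_of_generic {V : Finset E} {w : E → ℝ} (hw : IsGenericHeight V w) {x : E}
    (hx : x ∈ convexHull ℝ (V : Set E))
    (hgen : ∀ τ ⊆ V, x ∈ convexHull ℝ (τ : Set E) → affineSpan ℝ (τ : Set E) = ⊤) :
    ∃ σ, IsLowerCell V w σ ∧ x ∈ convexHull ℝ (σ : Set E) := by
  classical
  obtain ⟨t, ht0, ht1, htx, hopt⟩ := exists_optimal_weights V w hx
  let σ := V.filter fun v => t v ≠ 0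
  have hσV : σ ⊆ V := Finset.filter_subset _ _
  have hoff : ∀ v ∈ V, v ∉ σ → t v = 0 := fun v hv hvσ => by
    by_contra h; exact hvσ (Finset.mem_filter.2 ⟨hv, h⟩)
  have hxσ : x ∈ convexHull ℝ (σ : Set E) := by
    refine Finset.mem_convexHull'.2 ⟨t, fun v hv => ht0 v (hσV hv), ?_, ?_⟩
    · rw [← ht1]; exact Finset.sum_subset hσV hoff
    · rw [← htx]; exact Finset.sum_subset hσV fun v hv hvσ => by simp [hoff v hv hvσ]
  have hspan := hgen σ hσV hxσ
  have hind : AffineIndependent ℝ ((↑) : σ → E) := by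
    by_contra hdep
    obtain ⟨c, hc, hcσ, hne⟩ := hw σ hσV hdep
    have hz : ∀ v ∈ V, t v = 0 → c v = 0 := fun v _ h =>
      hcσ v fun hv => (Finset.mem_filter.1 hv).2 h
    have h1 := hopt c hc fun v hv h => (hz v hv h).ge
    have h2 := hopt (-c) hc.neg fun v hv h => by simp [hz v hv h]
    simp only [Pi.neg_apply, neg_mul, Finset.sum_neg_distrib] at h2
    exact hne (le_antisymm (by linarith) h1)
  obtain ⟨ℓ, hℓ⟩ := exists_affine_interpolation hind hspan w
  refine ⟨σ, ⟨hσV, hind, hspan, ℓ, hℓ, fun k hk hkσ => ?_⟩, hxσ⟩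
  have hdep : ¬ AffineIndependent ℝ ((↑) : ↥(insert k σ) → E) := by
    intro h
    have hk' : k ∈ insert k σ := Finset.mem_insert_self _ _
    refine h.notMem_affineSpan_sdiff ⟨k, hk'⟩ Set.univ ?_
    have : ((↑) : ↥(insert k σ) → E) '' (Set.univ \ {⟨k, hk'⟩}) = σ := by
      ext y
      simp only [Set.mem_image, Set.mem_sdiff, Set.mem_univ, true_and, Set.mem_singleton_iff,
        Subtype.exists, Subtype.mk.injEq, Finset.mem_insert, Finset.mem_coe]
      constructor
      · rintro ⟨a, ha, hne, rfl⟩; exact ha.resolve_left hne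
      · exact fun hy => ⟨y, Or.inr hy, fun h => hkσ (h ▸ hy), rfl⟩
    rw [this, hspan]; exact AffineSubspace.mem_top _ _ _
  obtain ⟨c, hc, hcτ, hne⟩ := hw _ (Finset.insert_subset hk hσV) hdep
  have hck : ∀ v ∉ σ, v ≠ k → c v = 0 := fun v hv hvk => hcτ v (by simp [hv, hvk])
  -- Only `k` contributes to the pairing of `c` with `w - ℓ`.
  have hval : ∑ v ∈ V, c v * w v = c k * (w k - ℓ k) := by
    have : ∑ v ∈ V, c v * w v = ∑ v ∈ V, c v * (w v - ℓ v) := by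
      simp_rw [mul_sub, Finset.sum_sub_distrib, hc.sum_mul_affine ℓ, sub_zero]
    rw [this, Finset.sum_eq_single k]
    · intro v _ hvk
      by_cases hvσ : v ∈ σ
      · simp [hℓ v hvσ]
      · simp [hck v hvσ hvk]
    · exact fun h => absurd hk h
  -- Optimality applies to `c` or `-c`, whichever is nonnegative at `k`; off `σ` all else is zero.
  have hsign : ∀ c', IsAffineRelation V c' → (∀ v ∉ σ, v ≠ k → c' v = 0) → 0 ≤ c' k →
      0 ≤ ∑ v ∈ V, c' v * w v := by
    intro c' hc' h0 hk0
    refine hopt c' hc' fun v hv htv => ?_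
    by_cases hvk : v = k
    · rwa [hvk]
    · exact (h0 v (fun h => (Finset.mem_filter.1 h).2 htv) hvk).ge
  rcases le_total 0 (c k) with h | h
  · have h1 := hsign c hc hck h
    rw [hval] at h1 hne
    have h2 : 0 < c k := h.lt_of_ne' (left_ne_zero_of_mul hne)
    have h3 := (mul_pos_iff_of_pos_left h2).1 (h1.lt_of_ne' hne)
    linarith
  · have h1 := hsign (-c) hc.neg (fun v hv hvk => by simp [hck v hv hvk]) (by simpa using h)
    simp only [Pi.neg_apply, neg_mul, Finset.sum_neg_distrib] at h1
    rw [hval] at h1 hne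
    have h2 : c k < 0 := h.lt_of_ne (left_ne_zero_of_mul hne)
    have h3 : c k * (w k - ℓ k) < 0 := lt_of_le_of_ne (by linarith) hne
    have h4 := pos_of_mul_neg_right h3 h2.le
    linarith

/-- Away from proper affine subspaces spanned by subsets of `V`, a point lies in at most one cell.
The interpolating functions of two cells through `x` both compute the least height over `x`. -/
lemma IsLowerCell.subset_of_mem_of_mem {V : Finset E} {w : E → ℝ} {σ τ : Finset E}
    (hσ : IsLowerCell V w σ) (hτ : IsLowerCell V w τ) {x : E}
    (hgen : ∀ τ ⊆ V, x ∈ convexHull ℝ (τ : Set E) → affineSpan ℝ (τ : Set E) = ⊤)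
    (hxσ : x ∈ convexHull ℝ (σ : Set E)) (hxτ : x ∈ convexHull ℝ (τ : Set E)) : τ ⊆ σ := by
  classical
  obtain ⟨ℓ, hℓσ, hℓ⟩ := hσ.exists_affine
  obtain ⟨m, hmτ, hm⟩ := hτ.exists_affine
  have heval : ∀ (f : E →ᵃ[ℝ] ℝ) (s : Finset E) (a : E → ℝ), ∑ v ∈ s, a v = 1 →
      ∑ v ∈ s, a v • v = x → f x = ∑ v ∈ s, a v * f v := by
    intro f s a h1 h2
    rw [sum_mul_affine_apply, h1, h2, one_mul]
    exact congrFun f.decomp x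
  have hle : ∀ (f : E →ᵃ[ℝ] ℝ) (s κ : Finset E), (∀ v ∈ κ, f v = w v) →
      (∀ v ∈ V, v ∉ κ → f v < w v) → s ⊆ V → ∀ v ∈ s, f v ≤ w v := by
    intro f s κ h1 h2 hs v hv
    by_cases hvκ : v ∈ κ
    · exact (h1 v hvκ).le
    · exact (h2 v (hs hv) hvκ).le
  obtain ⟨a, ha0, ha1, hax⟩ := Finset.mem_convexHull'.1 hxσ
  obtain ⟨b, hb0, hb1, hbx⟩ := Finset.mem_convexHull'.1 hxτ
  have hge : m x ≤ ℓ x := by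
    rw [heval m σ a ha1 hax, heval ℓ σ a ha1 hax]
    refine Finset.sum_le_sum fun v hv => mul_le_mul_of_nonneg_left ?_ (ha0 v hv)
    rw [hℓσ v hv]; exact hle m σ τ hmτ hm hσ.subset v hv
  intro k hk
  by_contra hkσ
  have hbk : b k = 0 := by
    by_contra hbk
    have hlt : ℓ x < m x := by
      rw [heval m τ b hb1 hbx, heval ℓ τ b hb1 hbx]
      refine Finset.sum_lt_sum (fun v hv => mul_le_mul_of_nonneg_left ?_ (hb0 v hv)) ⟨k, hk, ?_⟩
      · rw [hmτ v hv]; exact hle ℓ τ σ hℓσ hℓ hτ.subset v hv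
      · rw [hmτ k hk]
        exact mul_lt_mul_of_pos_left (hℓ k (hτ.subset hk) hkσ) ((hb0 k hk).lt_of_ne' hbk)
    exact absurd hge (not_le.2 hlt)
  have hx' : x ∈ convexHull ℝ ((τ.erase k : Finset E) : Set E) := by
    refine Finset.mem_convexHull'.2 ⟨b, fun v hv => hb0 v (Finset.mem_of_mem_erase hv), ?_, ?_⟩
    · rw [← hb1]; exact Finset.sum_erase _ hbk
    · rw [← hbx]; exact Finset.sum_erase _ (by simp [hbk])
  have hspan := hgen _ ((Finset.erase_subset _ _).trans hτ.subset) hx'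
  refine hτ.independent.notMem_affineSpan_sdiff ⟨k, hk⟩ Set.univ ?_
  have : ((↑) : τ → E) '' (Set.univ \ {⟨k, hk⟩}) = (τ.erase k : Finset E) := by
    ext y
    simp [and_comm]
  rw [this, hspan]; exact AffineSubspace.mem_top _ _ _

variable [FiniteDimensional ℝ E] [MeasurableSpace E] [BorelSpace E]

/-- The convex hull of a finite set `V` is, up to null sets, cut into finitely many simplices with
vertices in `V`; stated as additivity of integrals of continuous functions. -/
theorem exists_triangulation (μ : Measure E) [μ.IsAddHaarMeasure] (V : Finset E) :
    ∃ T : Finset (Finset E),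
      (∀ σ ∈ T, σ ⊆ V ∧ AffineIndependent ℝ ((↑) : σ → E) ∧ affineSpan ℝ (σ : Set E) = ⊤) ∧
      ∀ {F : Type*} [NormedAddCommGroup F] [NormedSpace ℝ F] (f : E → F), Continuous f →
        ∫ x in convexHull ℝ (V : Set E), f x ∂μ =
          ∑ σ ∈ T, ∫ x in convexHull ℝ (σ : Set E), f x ∂μ := by
  classical
  obtain ⟨w, hw⟩ := exists_isGenericHeight V
  let T := V.powerset.filter (IsLowerCell V w)
  have hT : ∀ σ ∈ T, IsLowerCell V w σ := fun σ hσ => (Finset.mem_filter.1 hσ).2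
  -- A proper affine subspace is a null set.
  have hgen : ∀ᵐ x ∂μ, ∀ τ ⊆ V, x ∈ convexHull ℝ (τ : Set E) →
      affineSpan ℝ (τ : Set E) = ⊤ := by
    have : ∀ᵐ x ∂μ, ∀ τ ∈ V.powerset, x ∈ convexHull ℝ (τ : Set E) →
        affineSpan ℝ (τ : Set E) = ⊤ := by
      rw [eventually_all_finset]
      intro τ _
      by_cases h : affineSpan ℝ (τ : Set E) = ⊤
      · exact Eventually.of_forall fun _ _ => h
      · have h0 := Measure.addHaar_affineSubspace μ _ h
        filter_upwards [measure_eq_zero_iff_ae_notMem.1 h0] with x hx hxτ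
        exact absurd (convexHull_subset_affineSpan _ hxτ) hx
    filter_upwards [this] with x hx τ hτ using hx τ (Finset.mem_powerset.2 hτ)
  refine ⟨T, fun σ hσ => ⟨(hT σ hσ).subset, (hT σ hσ).independent, (hT σ hσ).span_eq_top⟩, ?_⟩
  intro F _ _ f hf
  have hcpt : ∀ σ : Finset E, IsCompact (convexHull ℝ (σ : Set E)) := fun σ =>
    σ.finite_toSet.isCompact_convexHull ℝ
  have hcover : (convexHull ℝ (V : Set E)) =ᵐ[μ]
      ⋃ σ : T, convexHull ℝ ((σ : Finset E) : Set E) := by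
    filter_upwards [hgen] with x hx
    refine propext ⟨fun h => ?_, fun h => ?_⟩
    · obtain ⟨σ, hσ, hxσ⟩ := exists_isLowerCell_of_generic hw h hx
      exact Set.mem_iUnion.2
        ⟨⟨σ, Finset.mem_filter.2 ⟨Finset.mem_powerset.2 hσ.subset, hσ⟩⟩, hxσ⟩
    · obtain ⟨σ, hxσ⟩ := Set.mem_iUnion.1 h
      exact convexHull_mono (Finset.coe_subset.2 (hT σ σ.2).subset) hxσ
  rw [setIntegral_congr_set hcover, integral_iUnion_ae (ι := T)
    (fun σ => (hcpt σ).measurableSet.nullMeasurableSet) ?_ ?_, tsum_fintype,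
    Finset.sum_coe_sort T fun σ => ∫ x in convexHull ℝ (σ : Set E), f x ∂μ]
  · intro σ τ hne
    refine measure_eq_zero_iff_ae_notMem.2 ?_
    filter_upwards [hgen] with x hx hmem
    exact hne (Subtype.ext (Finset.Subset.antisymm
      ((hT _ τ.2).subset_of_mem_of_mem (hT _ σ.2) hx hmem.2 hmem.1)
      ((hT _ σ.2).subset_of_mem_of_mem (hT _ τ.2) hx hmem.1 hmem.2)))
  · exact integrableOn_finite_iUnion.2 fun σ => hf.continuousOn.integrableOn_compact (hcpt σ)

end Triangulation

/-! ### Moments of a simplex as integrals over an orthant -/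

section Cone

open scoped Pointwise

variable {E : Type*} [NormedAddCommGroup E] [NormedSpace ℝ E] {ι : Type*} [Fintype ι]

lemma integral_pow_mul_exp_neg (n : ℕ) :
    ∫ r : ℝ in Set.Ioi 0, Real.exp (-r) * r ^ n = n.factorial := by
  rw [← Real.Gamma_nat_eq_factorial, Real.Gamma_eq_integral (by positivity)]
  refine setIntegral_congr_fun measurableSet_Ioi fun r _ => ?_
  simp

lemma integrableOn_pow_mul_exp_neg (n : ℕ) :
    IntegrableOn (fun r : ℝ => Real.exp (-r) * r ^ n) (Set.Ici 0) := by
  rw [integrableOn_Ici_iff_integrableOn_Ioi]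
  refine (Real.GammaIntegral_convergent (s := n + 1) (by positivity)).congr_fun (fun r _ => ?_)
    measurableSet_Ioi
  simp

/-- The linear map sending the standard basis of `ℝ^ι` to the lifted points `(1, v i)`. -/
noncomputable def coneMap (v : ι → E) : (ι → ℝ) →ₗ[ℝ] ℝ × E :=
  (∑ i, LinearMap.proj i).prod (∑ i, (LinearMap.proj i : (ι → ℝ) →ₗ[ℝ] ℝ).smulRight (v i))

lemma coneMap_apply (v : ι → E) (s : ι → ℝ) : coneMap v s = (∑ i, s i, ∑ i, s i • v i) := by
  simp [coneMap]

lemma coneMap_injective {v : ι → E} (hv : AffineIndependent ℝ v) :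
    Function.Injective (coneMap v) := by
  classical
  rw [injective_iff_map_eq_zero]
  intro s hs
  rw [coneMap_apply, Prod.mk_eq_zero] at hs
  rw [affineIndependent_iff] at hv
  ext i
  exact hv Finset.univ s hs.1 hs.2 i (Finset.mem_univ i)

lemma mem_convexHull_range_iff (v : ι → E) (x : E) :
    x ∈ convexHull ℝ (Set.range v) ↔
      ∃ s : ι → ℝ, (∀ i, 0 ≤ s i) ∧ ∑ i, s i = 1 ∧ ∑ i, s i • v i = x := by
  classical
  have : Set.range v = ⇑(∑ i, (LinearMap.proj i : (ι → ℝ) →ₗ[ℝ] ℝ).smulRight (v i)) ''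
      Set.range (fun i : ι => (Pi.single i 1 : ι → ℝ)) := by
    rw [← Set.range_comp]
    congr 1
    ext i
    simp [Pi.single_apply]
  rw [this, ← LinearMap.image_convexHull, convexHull_rangle_single_eq_stdSimplex]
  simp [stdSimplex, and_assoc]

variable [FiniteDimensional ℝ E]

/-- The isomorphism `ℝ^ι ≃ ℝ × E` given by the lifted vertices `(1, v i)` of a simplex. -/
noncomputable def coneEquiv {v : ι → E} (hv : AffineIndependent ℝ v)
    (hcard : Fintype.card ι = Module.finrank ℝ E + 1) : (ι → ℝ) ≃L[ℝ] ℝ × E :=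
  (LinearMap.linearEquivOfInjective (coneMap v) (coneMap_injective hv)
    (by simp [hcard, add_comm])).toContinuousLinearEquiv

lemma coneEquiv_apply {v : ι → E} (hv : AffineIndependent ℝ v)
    (hcard : Fintype.card ι = Module.finrank ℝ E + 1) (s : ι → ℝ) :
    coneEquiv hv hcard s = (∑ i, s i, ∑ i, s i • v i) := by
  rw [← coneMap_apply]; rfl

variable [MeasurableSpace E] [BorelSpace E] (μ : Measure E) [μ.IsAddHaarMeasure]

/-- The moments of a simplex against a homogeneous integrand: integrating over the cone
`{(r, y) | y ∈ r • Δ}` with weight `e^{-r}` produces `(n + dim)!` times the integral over `Δ`, and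
the lifted vertices identify this cone with an orthant. The constant only depends on `Δ`. -/
theorem exists_factorial_smul_integral_simplex {v : ι → E} (hv : AffineIndependent ℝ v)
    (hcard : Fintype.card ι = Module.finrank ℝ E + 1) :
    ∃ c : ℝ, ∀ {F : Type*} [NormedAddCommGroup F] [NormedSpace ℝ F] [CompleteSpace F]
      (n : ℕ) (h : E → F), (∀ (r : ℝ) x, h (r • x) = r ^ n • h x) →
      IntegrableOn (fun s : ι → ℝ => Real.exp (-∑ i, s i) • h (∑ i, s i • v i)) (Set.Ici 0) →
      ((n + Module.finrank ℝ E).factorial : ℝ) • ∫ x in convexHull ℝ (Set.range v), h x ∂μ =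
        c • ∫ s in Set.Ici (0 : ι → ℝ), Real.exp (-∑ i, s i) • h (∑ i, s i • v i) := by
  classical
  let L := coneEquiv hv hcard
  have hL : ∀ s, L s = (∑ i, s i, ∑ i, s i • v i) := coneEquiv_apply hv hcard
  let e : (ι → ℝ) ≃ᵐ ℝ × E := L.toHomeomorph.toMeasurableEquiv
  have he : ∀ s, e s = L s := fun _ => rfl
  let ν : Measure (ℝ × E) := Measure.map L volume
  have hν : ν.IsAddHaarMeasure := L.isAddHaarMeasure_map volume
  let k := ((volume : Measure ℝ).prod μ).addHaarScalarFactor ν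
  have hk : (volume : Measure ℝ).prod μ = k • ν := Measure.isAddLeftInvariant_eq_smul _ _
  refine ⟨k, fun {F} _ _ _ n h hh hint => ?_⟩
  let C : Set (ℝ × E) := e.symm ⁻¹' Set.Ici 0
  have hC : MeasurableSet C := e.symm.measurable measurableSet_Ici
  have hCpre : e ⁻¹' C = Set.Ici 0 := by ext s; simp [C]
  let G : ℝ × E → F := fun p => Real.exp (-p.1) • h p.2
  have hGe : ∀ s, G (e s) = Real.exp (-∑ i, s i) • h (∑ i, s i • v i) := fun s => by
    simp only [G, he, hL]
  have hνe : ν = Measure.map e volume := rfl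
  have hintG : IntegrableOn G C ((volume : Measure ℝ).prod μ) := by
    rw [hk, IntegrableOn, Measure.restrict_smul]
    refine Integrable.smul_measure_nnreal ?_
    rw [← IntegrableOn, hνe, e.measurableEmbedding.integrableOn_map_iff, hCpre]
    exact hint.congr_fun (fun s _ => (hGe s).symm) measurableSet_Ici
  have hRHS : ∫ p in C, G p ∂((volume : Measure ℝ).prod μ) =
      (k : ℝ) • ∫ s in Set.Ici (0 : ι → ℝ), Real.exp (-∑ i, s i) • h (∑ i, s i • v i) := by
    rw [hk, Measure.restrict_smul, integral_smul_nnreal_measure, hνe,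
      e.measurableEmbedding.setIntegral_map, hCpre]
    simp_rw [hGe]
    rfl
  -- The slices of the cone are the dilates of the simplex.
  have hslice : ∀ r : ℝ, 0 < r → ∀ y, (r, y) ∈ C ↔ y ∈ r • convexHull ℝ (Set.range v) := by
    intro r hr y
    rw [Set.mem_smul_set_iff_inv_smul_mem₀ hr.ne', mem_convexHull_range_iff]
    constructor
    · intro hy
      have h1 : L (e.symm (r, y)) = (r, y) := e.apply_symm_apply _
      rw [hL, Prod.mk.injEq] at h1
      refine ⟨fun i => r⁻¹ * e.symm (r, y) i, fun i => ?_, ?_, ?_⟩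
      · exact mul_nonneg (inv_nonneg.2 hr.le) (hy i)
      · rw [← Finset.mul_sum, h1.1, inv_mul_cancel₀ hr.ne']
      · simp_rw [mul_smul, ← Finset.smul_sum, h1.2]
    · rintro ⟨s, hs0, hs1, hsy⟩
      have h1 : L (r • s) = (r, y) := by
        rw [map_smul, hL, hs1, hsy]
        simp [hr.ne']
      have h2 : e.symm (r, y) = r • s := by rw [← h1]; exact e.symm_apply_apply _
      change e.symm (r, y) ∈ Set.Ici 0
      rw [h2]
      exact fun i => mul_nonneg hr.le (hs0 i)
  have hslice_neg : ∀ r : ℝ, r < 0 → ∀ y, (r, y) ∉ C := by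
    intro r hr y hy
    have h1 : L (e.symm (r, y)) = (r, y) := e.apply_symm_apply _
    rw [hL, Prod.mk.injEq] at h1
    have : 0 ≤ r := h1.1 ▸ Finset.sum_nonneg fun i _ => hy i
    linarith
  have hKm : MeasurableSet (convexHull ℝ (Set.range v)) :=
    ((Set.finite_range v).isCompact_convexHull ℝ).measurableSet
  have hinner : ∀ r : ℝ, r ≠ 0 → ∫ y, C.indicator G (r, y) ∂μ =
      (Set.Ioi (0 : ℝ)).indicator (fun r => (Real.exp (-r) * r ^ (n + Module.finrank ℝ E)) •
        ∫ x in convexHull ℝ (Set.range v), h x ∂μ) r := by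
    intro r hr0
    rcases lt_or_gt_of_ne hr0 with hr | hr
    · rw [Set.indicator_of_notMem (by simp [hr.le])]
      simp [Set.indicator_of_notMem (hslice_neg r hr _)]
    · rw [Set.indicator_of_mem (Set.mem_Ioi.2 hr)]
      have h1 : (fun y => C.indicator G (r, y)) =
          (r • convexHull ℝ (Set.range v)).indicator (fun y => Real.exp (-r) • h y) := by
        ext y
        by_cases hy : (r, y) ∈ C
        · rw [Set.indicator_of_mem hy, Set.indicator_of_mem ((hslice r hr y).1 hy)]
        · rw [Set.indicator_of_notMem hy, Set.indicator_of_notMem (mt (hslice r hr y).2 hy)]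
      rw [h1, integral_indicator (hKm.const_smul₀ r), integral_smul]
      have h2 := Measure.setIntegral_comp_smul_of_pos μ h (convexHull ℝ (Set.range v)) hr
      rw [eq_inv_smul_iff₀ (by positivity)] at h2
      simp_rw [hh, integral_smul] at h2
      rw [← h2, smul_smul, smul_smul, pow_add]
      ring_nf
  have hLHS : ∫ p in C, G p ∂((volume : Measure ℝ).prod μ) =
      ((n + Module.finrank ℝ E).factorial : ℝ) • ∫ x in convexHull ℝ (Set.range v), h x ∂μ := by
    rw [← integral_indicator hC, integral_prod _ ((integrable_indicator_iff hC).2 hintG)]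
    have hae : ∀ᵐ r : ℝ, r ≠ 0 := by simp [ae_iff, measure_singleton]
    rw [integral_congr_ae (hae.mono fun r hr => hinner r hr),
      integral_indicator measurableSet_Ioi, integral_smul_const, integral_pow_mul_exp_neg]
  rw [← hLHS, hRHS]

end Cone
/-! ### Formal power series with separated coefficients -/

section Formal

variable {K : Type*} [Field K] {ι : Type*} [Fintype ι]

/-- The multivariate power series `∏ j, f j (X j)`, given by its coefficients. -/
noncomputable def productSeries (f : ι → PowerSeries K) : MvPowerSeries ι K :=
  fun β => ∏ j, PowerSeries.coeff (β j) (f j)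

lemma coeff_productSeries (f : ι → PowerSeries K) (β : ι →₀ ℕ) :
    MvPowerSeries.coeff β (productSeries f) = ∏ j, PowerSeries.coeff (β j) (f j) := rfl

lemma one_sub_X_mul_productSeries [DecidableEq ι] (f : ι → PowerSeries K) (j : ι) :
    (1 - MvPowerSeries.X j) * productSeries f =
      productSeries (Function.update f j ((1 - PowerSeries.X) * f j)) := by
  ext β
  have hupd : ∀ (g : PowerSeries K) (γ : ι →₀ ℕ), (∀ i, i ≠ j → γ i = β i) →
      ∏ i, PowerSeries.coeff (γ i) (Function.update f j g i) =
        PowerSeries.coeff (γ j) g * ∏ i ∈ Finset.univ.erase j, PowerSeries.coeff (β i) (f i) := by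
    intro g γ hγ
    rw [← Finset.mul_prod_erase _ _ (Finset.mem_univ j), Function.update_self]
    congr 1
    refine Finset.prod_congr rfl fun i hi => ?_
    rw [Function.update_of_ne (Finset.ne_of_mem_erase hi), hγ i (Finset.ne_of_mem_erase hi)]
  have hf : ∀ γ : ι →₀ ℕ, (∀ i, i ≠ j → γ i = β i) → ∏ i, PowerSeries.coeff (γ i) (f i) =
      PowerSeries.coeff (γ j) (f j) *
        ∏ i ∈ Finset.univ.erase j, PowerSeries.coeff (β i) (f i) := by
    intro γ hγ
    rw [← hupd _ γ hγ, Function.update_eq_self]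
  rw [sub_mul, one_mul, map_sub, coeff_productSeries, coeff_productSeries,
    hupd _ β (fun _ _ => rfl), hf β (fun _ _ => rfl), MvPowerSeries.X,
    MvPowerSeries.coeff_monomial_mul, one_mul, sub_mul, one_mul, map_sub, sub_mul]
  congr 1
  rcases h : β j with _ | k
  · rw [if_neg (by intro hle; have := hle j; simp [h] at this), PowerSeries.coeff_zero_X_mul,
      zero_mul]
  · rw [if_pos (by rw [Finsupp.single_le_iff, h]; omega), coeff_productSeries,
      hf (β - Finsupp.single j 1) (fun i hi => by simp [hi.symm]),
      PowerSeries.coeff_succ_X_mul]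
    simp [h]

lemma one_sub_X_pow_mul_productSeries [DecidableEq ι] (f : ι → PowerSeries K) (j : ι) (m : ℕ) :
    (1 - MvPowerSeries.X j) ^ m * productSeries f =
      productSeries (Function.update f j ((1 - PowerSeries.X) ^ m * f j)) := by
  induction m with
  | zero => simp
  | succ m ih =>
    rw [pow_succ', mul_assoc, ih, one_sub_X_mul_productSeries]
    simp [pow_succ', mul_assoc]

lemma prod_one_sub_X_pow_mul_productSeries (f : ι → PowerSeries K) (m : ℕ) :
    (∏ j, (1 - MvPowerSeries.X j) ^ m) * productSeries f =
      productSeries (fun j => (1 - PowerSeries.X) ^ m * f j) := by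
  classical
  have key : ∀ s : Finset ι, (∏ j ∈ s, (1 - MvPowerSeries.X j) ^ m) * productSeries f =
      productSeries (fun j => if j ∈ s then (1 - PowerSeries.X) ^ m * f j else f j) := by
    intro s
    induction s using Finset.induction_on with
    | empty => simp
    | insert a s ha ih =>
      rw [Finset.prod_insert ha, mul_assoc, ih, one_sub_X_pow_mul_productSeries]
      congr 1
      ext1 i
      by_cases hi : i = a
      · subst hi; simp [ha]
      · simp [hi]
  simpa using key Finset.univ

lemma exists_productSeries_eq_coe (g : ι → Polynomial K) :
    ∃ p : MvPolynomial ι K, productSeries (fun j => (g j : PowerSeries K)) = p := by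
  classical
  let N : ι →₀ ℕ := Finsupp.equivFunOnFinite.symm fun j => (g j).natDegree
  refine ⟨MvPowerSeries.trunc' K N (productSeries fun j => (g j : PowerSeries K)), ?_⟩
  ext β
  rw [MvPolynomial.coeff_coe, MvPowerSeries.coeff_trunc']
  split_ifs with h
  · rfl
  · obtain ⟨j, hj⟩ := not_forall.1 h
    rw [coeff_productSeries]
    refine Finset.prod_eq_zero (Finset.mem_univ j) ?_
    rw [Polynomial.coeff_coe]
    exact Polynomial.coeff_eq_zero_of_natDegree_lt (not_le.1 hj)

lemma one_sub_X_pow_mul_mk_factorial [CharZero K] {a m : ℕ} (h : a ≤ m) :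
    (1 - PowerSeries.X) ^ (m + 1) *
      PowerSeries.mk (fun n => ((a + n).factorial : K) / (n.factorial : K)) =
      ((Polynomial.C (a.factorial : K) * (1 - Polynomial.X) ^ (m - a) : Polynomial K) :
        PowerSeries K) := by
  have h1 : PowerSeries.mk (fun n => ((a + n).factorial : K) / (n.factorial : K)) =
      PowerSeries.C (a.factorial : K) * PowerSeries.mk fun n => ((a + n).choose a : K) := by
    ext n
    rw [PowerSeries.coeff_C_mul, PowerSeries.coeff_mk, PowerSeries.coeff_mk,
      Nat.cast_choose K (Nat.le_add_right a n), Nat.add_sub_cancel_left]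
    field_simp [Nat.factorial_ne_zero]
  have h2 := PowerSeries.mk_add_choose_mul_one_sub_pow_eq_one K a
  rw [h1, show m + 1 = (m - a) + (a + 1) by omega, pow_add]
  push_cast
  linear_combination (PowerSeries.C (a.factorial : K) * (1 - PowerSeries.X) ^ (m - a)) * h2

/-- The series in question is the expansion of `∏ j, a j ! / (1 - X j) ^ (a j + 1)`. -/
lemma exists_prod_one_sub_X_pow_mul_eq_coe [CharZero K] (a : ι → ℕ) (m : ℕ) (ha : ∀ j, a j ≤ m) :
    ∃ p : MvPolynomial ι K, (∏ j, (1 - MvPowerSeries.X j) ^ (m + 1)) *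
      productSeries (fun j =>
        PowerSeries.mk fun n => ((a j + n).factorial : K) / (n.factorial : K)) = p := by
  simp_rw [prod_one_sub_X_pow_mul_productSeries, one_sub_X_pow_mul_mk_factorial (ha _)]
  exact exists_productSeries_eq_coe _

/-- The linear form `⟨v, X⟩`. -/
noncomputable def linearForm {κ : Type*} [Fintype κ] (v : κ → K) : MvPolynomial κ K :=
  ∑ i, MvPolynomial.C (v i) * MvPolynomial.X i

variable {κ : Type*} [Fintype κ]

lemma isHomogeneous_linearForm (v : κ → K) : (linearForm v).IsHomogeneous 1 :=
  MvPolynomial.IsHomogeneous.sum _ _ _ fun i _ => by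
    simpa using (MvPolynomial.isHomogeneous_C κ (v i)).mul (MvPolynomial.isHomogeneous_X K i)

lemma sum_finsuppAntidiag_univ [DecidableEq κ] {M : Type*} [AddCommMonoid M] (n : ℕ)
    (g : (κ → ℕ) → M) :
    ∑ β ∈ Finset.univ.finsuppAntidiag n, g ⇑β = ∑ β ∈ Finset.piAntidiag Finset.univ n, g β := by
  refine Finset.sum_bij' (fun (β : κ →₀ ℕ) _ => (⇑β : κ → ℕ))
    (fun β _ => Finsupp.equivFunOnFinite.symm β) ?_ ?_ ?_ ?_ ?_
  · intro β hβ; simpa [Finset.mem_piAntidiag] using (Finset.mem_finsuppAntidiag.1 hβ).1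
  · intro β hβ; simpa using (Finset.mem_piAntidiag.1 hβ).1
  · intro β _; ext; simp
  · intro β _; ext; simp
  · intro β _; rfl

lemma multinomial_univ_eq_div [CharZero K] [DecidableEq κ] (f : κ → ℕ) :
    (Nat.multinomial Finset.univ f : K) =
      ((∑ i, f i).factorial : K) / ∏ i, ((f i).factorial : K) := by
  rw [eq_div_iff (Finset.prod_ne_zero_iff.2 fun i _ => by exact_mod_cast Nat.factorial_ne_zero _),
    mul_comm]
  exact_mod_cast Nat.multinomial_spec Finset.univ f

/-- The monomials of degree `n` of a linear substitution, obtained by comparing the two multinomial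
expansions of `⟨∑ j, s j • v j, X⟩ ^ n`. -/
lemma prod_pow_div_factorial_eq_sum [CharZero K] [DecidableEq ι] (v : ι → κ → K) (s : ι → K)
    (I : κ →₀ ℕ) :
    (∏ i, (∑ j, s j * v j i) ^ I i) / ∏ i, ((I i).factorial : K) =
      ∑ β ∈ Finset.univ.finsuppAntidiag (∑ i, I i),
        ((∏ j, s j ^ β j) / ∏ j, ((β j).factorial : K)) *
          MvPolynomial.coeff I (∏ j, linearForm (v j) ^ β j) := by
  classical
  have hfac : ∀ n : ℕ, (n.factorial : K) ≠ 0 := fun n => by exact_mod_cast Nat.factorial_ne_zero n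
  set n := ∑ i, I i with hn
  have hlin : (∑ i, (∑ j, s j * v j i) • MvPolynomial.X i : MvPolynomial κ K) =
      ∑ j, MvPolynomial.C (s j) * linearForm (v j) := by
    simp_rw [linearForm, Finset.mul_sum, Finset.sum_smul]
    rw [Finset.sum_comm]
    refine Finset.sum_congr rfl fun j _ => Finset.sum_congr rfl fun i _ => ?_
    rw [MvPolynomial.smul_eq_C_mul, map_mul, mul_assoc]
  have h1 := MvPolynomial.coeff_linearCombination_X_pow_of_fintype
    (fun i => ∑ j, s j * v j i) I n
  have hsum : I.sum (fun _ m => m) = n := Finsupp.sum_fintype _ _ fun _ => rfl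
  rw [if_pos hsum, hlin, Finset.sum_pow_eq_sum_piAntidiag, MvPolynomial.coeff_sum,
    Finsupp.prod_fintype _ _ (fun _ => pow_zero _),
    Finsupp.multinomial_eq_of_support_subset (Finset.subset_univ _), multinomial_univ_eq_div,
    ← hn] at h1
  have h2 : (n.factorial : K) * ((∏ i, (∑ j, s j * v j i) ^ I i) / ∏ i, ((I i).factorial : K)) =
      ∑ β ∈ Finset.piAntidiag Finset.univ n, (n.factorial : K) *
        (((∏ j, s j ^ β j) / ∏ j, ((β j).factorial : K)) *
          MvPolynomial.coeff I (∏ j, linearForm (v j) ^ β j)) := by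
    rw [← mul_div_assoc, mul_div_right_comm, ← h1]
    refine Finset.sum_congr rfl fun β hβ => ?_
    have hβn : ∑ j, β j = n := (Finset.mem_piAntidiag.1 hβ).1
    simp_rw [mul_pow, Finset.prod_mul_distrib, ← map_pow, ← map_prod, ← map_natCast
      (MvPolynomial.C : K →+* MvPolynomial κ K), MvPolynomial.coeff_C_mul,
      multinomial_univ_eq_div, hβn]
    ring
  rw [← Finset.mul_sum] at h2
  rw [mul_left_cancel₀ (hfac n) h2]
  exact (sum_finsuppAntidiag_univ n _).symm

lemma hasSubst_linearForm (v : ι → κ → K) :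
    MvPowerSeries.HasSubst (S := K) fun j => (linearForm (v j) : MvPowerSeries κ K) := by
  refine MvPowerSeries.hasSubst_of_constantCoeff_zero fun j => ?_
  rw [← MvPowerSeries.coeff_zero_eq_constantCoeff_apply, MvPolynomial.coeff_coe, linearForm,
    MvPolynomial.coeff_sum]
  exact Finset.sum_eq_zero fun i _ => by simp [MvPolynomial.coeff_C_mul]

lemma coeff_subst_linearForm [DecidableEq ι] (v : ι → κ → K) (W : MvPowerSeries ι K)
    (I : κ →₀ ℕ) :
    MvPowerSeries.coeff I
        (MvPowerSeries.subst (fun j => (linearForm (v j) : MvPowerSeries κ K)) W) =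
      ∑ β ∈ Finset.univ.finsuppAntidiag (∑ i, I i), MvPowerSeries.coeff β W *
        MvPolynomial.coeff I (∏ j, linearForm (v j) ^ β j) := by
  classical
  have hprod : ∀ β : ι →₀ ℕ, (β.prod fun j e => (linearForm (v j) : MvPowerSeries κ K) ^ e) =
      ((∏ j, linearForm (v j) ^ β j : MvPolynomial κ K) : MvPowerSeries κ K) := by
    intro β
    rw [Finsupp.prod_fintype _ _ (fun _ => pow_zero _),
      ← MvPolynomial.coeToMvPowerSeries.ringHom_apply, map_prod]
    simp
  rw [MvPowerSeries.coeff_subst (hasSubst_linearForm v)]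
  simp_rw [hprod, MvPolynomial.coeff_coe, smul_eq_mul]
  refine finsum_eq_sum_of_support_subset _ fun β hβ => ?_
  have hne := right_ne_zero_of_mul (Function.mem_support.1 hβ)
  have hhom : (∏ j, linearForm (v j) ^ β j).IsHomogeneous (∑ j, β j) :=
    MvPolynomial.IsHomogeneous.prod _ _ _ fun j _ => by
      simpa using (isHomogeneous_linearForm (v j)).pow (β j)
  have := hhom hne
  rw [Finset.mem_coe, Finset.mem_finsuppAntidiag]
  refine ⟨?_, Finset.subset_univ _⟩
  rw [← this, Finsupp.weight_apply, Finsupp.sum_fintype _ _ (by simp)]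
  simp

/-- Substituting linear forms into a power series with denominator `∏ j, (1 - X j) ^ m`. -/
lemma prod_one_sub_linearForm_pow_mul_subst (v : ι → κ → K) {W : MvPowerSeries ι K} {m : ℕ}
    {p : MvPolynomial ι K} (h : (∏ j, (1 - MvPowerSeries.X j) ^ m) * W = p) :
    ((∏ j, (1 - linearForm (v j)) ^ m : MvPolynomial κ K) : MvPowerSeries κ K) *
        MvPowerSeries.subst (fun j => (linearForm (v j) : MvPowerSeries κ K)) W =
      (MvPolynomial.aeval (fun j => linearForm (v j)) p : MvPolynomial κ K) := by
  have hs := hasSubst_linearForm v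
  have h1 := congrArg (MvPowerSeries.substAlgHom hs) h
  rw [map_mul, MvPowerSeries.substAlgHom_coe, map_prod] at h1
  simp_rw [map_pow, map_sub, map_one, MvPowerSeries.substAlgHom_X] at h1
  rw [← MvPowerSeries.coe_substAlgHom hs]
  have h2 : (MvPolynomial.aeval (fun j => (linearForm (v j) : MvPowerSeries κ K))) p =
      ((MvPolynomial.aeval (fun j => linearForm (v j)) p : MvPolynomial κ K) :
        MvPowerSeries κ K) := by
    rw [← MvPolynomial.coeToMvPowerSeries.ringHom_apply, MvPolynomial.aeval_def,
      MvPolynomial.aeval_def, MvPolynomial.hom_eval₂]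
    congr 1
    ext1 r
    simp [MvPolynomial.algebraMap_eq, MvPowerSeries.algebraMap_apply]
  rw [← h2, ← h1]
  congr 1
  rw [← MvPolynomial.coeToMvPowerSeries.ringHom_apply, map_prod]
  simp_rw [map_pow, map_sub, map_one, MvPolynomial.coeToMvPowerSeries.ringHom_apply]

end Formal
/-! ### The moment generating function of a simplex -/

section Simplex

variable {𝕜 : Type*} [RCLike 𝕜] {ι : Type*} [Fintype ι]

lemma exp_neg_sum_smul_prod_pow (β : ι → ℕ) (s : ι → ℝ) :
    Real.exp (-∑ j, s j) • ∏ j, ((s j : ℝ) : 𝕜) ^ β j =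
      ∏ j, ((Real.exp (-s j) * s j ^ β j : ℝ) : 𝕜) := by
  rw [← Finset.sum_neg_distrib, Real.exp_sum, RCLike.real_smul_eq_coe_mul,
    RCLike.ofReal_prod, ← Finset.prod_mul_distrib]
  simp

lemma volume_restrict_Ici_zero :
    (volume : Measure (ι → ℝ)).restrict (Set.Ici 0) =
      Measure.pi fun _ => (volume : Measure ℝ).restrict (Set.Ici 0) := by
  rw [← Measure.restrict_pi_pi, Set.pi_univ_Ici]; rfl

lemma integrableOn_exp_neg_sum_smul_prod_pow (β : ι → ℕ) :
    IntegrableOn (fun s : ι → ℝ => Real.exp (-∑ j, s j) • ∏ j, ((s j : ℝ) : 𝕜) ^ β j)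
      (Set.Ici 0) := by
  simp_rw [exp_neg_sum_smul_prod_pow]
  rw [IntegrableOn, volume_restrict_Ici_zero]
  exact Integrable.fintype_prod (f := fun j (x : ℝ) => ((Real.exp (-x) * x ^ β j : ℝ) : 𝕜))
    fun j => (integrableOn_pow_mul_exp_neg (β j)).ofReal

lemma integral_exp_neg_sum_smul_prod_pow (β : ι → ℕ) :
    ∫ s in Set.Ici (0 : ι → ℝ), Real.exp (-∑ j, s j) • ∏ j, ((s j : ℝ) : 𝕜) ^ β j =
      ∏ j, ((β j).factorial : 𝕜) := by
  simp_rw [exp_neg_sum_smul_prod_pow]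
  rw [volume_restrict_Ici_zero, integral_fintype_prod_eq_prod
    (fun j (x : ℝ) => ((Real.exp (-x) * x ^ β j : ℝ) : 𝕜))]
  refine Finset.prod_congr rfl fun j _ => ?_
  rw [integral_ofReal, integral_Ici_eq_integral_Ioi, integral_pow_mul_exp_neg]
  simp

variable {d : ℕ}

lemma eval_real_smul {ρ : MvPolynomial (Fin d) 𝕜} {δ : ℕ} (hρ : ρ.IsHomogeneous δ) (r : ℝ)
    (x : EuclideanSpace ℝ (Fin d)) :
    MvPolynomial.eval (fun i => (((r • x) i : ℝ) : 𝕜)) ρ =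
      (r : 𝕜) ^ δ * MvPolynomial.eval (fun i => ((x i : ℝ) : 𝕜)) ρ := by
  rw [MvPolynomial.eval_eq', MvPolynomial.eval_eq', Finset.mul_sum]
  refine Finset.sum_congr rfl fun α hα => ?_
  have hdeg : ∑ i, α i = δ := by
    rw [← hρ (MvPolynomial.mem_support_iff.1 hα), Finsupp.weight_apply,
      Finsupp.sum_fintype _ _ (by simp)]
    simp
  simp only [PiLp.smul_apply, smul_eq_mul, map_mul, mul_pow, Finset.prod_mul_distrib,
    Finset.prod_pow_eq_pow_sum, hdeg]
  ring

/-- For a simplex the denominator of the moment generating function is a product of powers of the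
linear forms of its vertices. Up to a constant, the generating function is obtained by substituting
`X j ↦ ⟨v j, u⟩` in `∑ α, r α ∏ j, α j ! / (1 - X j) ^ (α j + 1)`, where the `r α` are the
coefficients of the density in barycentric coordinates. -/
theorem exists_dualForm_mul_momentGenFun_simplex {v : ι → EuclideanSpace ℝ (Fin d)}
    (hv : AffineIndependent ℝ v) (hcard : Fintype.card ι = d + 1) (δ : ℕ)
    (ρ : MvPolynomial (Fin d) 𝕜) (hρ : ρ.IsHomogeneous δ) :
    ∃ p : MvPolynomial (Fin d) 𝕜,
      ((∏ j, dualForm 𝕜 (v j) ^ (δ + 1) : MvPolynomial (Fin d) 𝕜) : MvPowerSeries (Fin d) 𝕜) *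
        momentGenFun δ ρ (standardMeasure (convexHull ℝ (Set.range v))) = p := by
  classical
  obtain ⟨c, hc⟩ := exists_factorial_smul_integral_simplex
    (volume : Measure (EuclideanSpace ℝ (Fin d))) hv (by simpa using hcard)
  let w : ι → Fin d → 𝕜 := fun j i => ((v j i : ℝ) : 𝕜)
  let R : MvPolynomial ι 𝕜 := MvPolynomial.aeval (fun i => linearForm fun j => w j i) ρ
  have hR : R.IsHomogeneous δ := by
    rw [← one_mul δ]
    exact hρ.aeval _ fun i => isHomogeneous_linearForm _
  have hRle : ∀ α ∈ R.support, ∀ j, α j ≤ δ := by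
    intro α hα j
    have hdeg : ∑ j, α j = δ := by
      rw [← hR (MvPolynomial.mem_support_iff.1 hα), Finsupp.weight_apply,
        Finsupp.sum_fintype _ _ (by simp)]
      simp
    rw [← hdeg]
    exact Finset.single_le_sum (f := fun j => α j) (fun _ _ => Nat.zero_le _) (Finset.mem_univ j)
  let B : (ι →₀ ℕ) → MvPowerSeries ι 𝕜 := fun α => productSeries fun j =>
    PowerSeries.mk fun n => ((α j + n).factorial : 𝕜) / (n.factorial : 𝕜)
  let W : MvPowerSeries ι 𝕜 := ∑ α ∈ R.support, MvPowerSeries.C (R.coeff α) * B α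
  have hWcoeff : ∀ β, MvPowerSeries.coeff β W = ∑ α ∈ R.support,
      R.coeff α * ((∏ j, ((α j + β j).factorial : 𝕜)) / ∏ j, ((β j).factorial : 𝕜)) := by
    intro β
    simp only [W, B, map_sum, MvPowerSeries.coeff_C_mul, coeff_productSeries,
      PowerSeries.coeff_mk, Finset.prod_div_distrib]
  have hW : ∃ p : MvPolynomial ι 𝕜, (∏ j, (1 - MvPowerSeries.X j) ^ (δ + 1)) * W = p := by
    have h : ∀ α : ι →₀ ℕ, ∃ p : MvPolynomial ι 𝕜, α ∈ R.support →
        (∏ j, (1 - MvPowerSeries.X j) ^ (δ + 1)) * B α = p := by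
      intro α
      by_cases hα : α ∈ R.support
      · obtain ⟨p, hp⟩ := exists_prod_one_sub_X_pow_mul_eq_coe (K := 𝕜) α δ (hRle α hα)
        exact ⟨p, fun _ => hp⟩
      · exact ⟨0, fun h => absurd h hα⟩
    choose p hp using h
    refine ⟨∑ α ∈ R.support, MvPolynomial.C (R.coeff α) * p α, ?_⟩
    rw [← MvPolynomial.coeToMvPowerSeries.ringHom_apply, map_sum, Finset.mul_sum]
    refine Finset.sum_congr rfl fun α hα => ?_
    rw [mul_left_comm, hp α hα]
    simp
  obtain ⟨p, hp⟩ := hW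
  have hmain := prod_one_sub_linearForm_pow_mul_subst w hp
  have hF : momentGenFun δ ρ (standardMeasure (convexHull ℝ (Set.range v))) =
      MvPowerSeries.C (c : 𝕜) *
        MvPowerSeries.subst (fun j => (linearForm (w j) : MvPowerSeries (Fin d) 𝕜)) W := by
    ext I
    rw [MvPowerSeries.coeff_C_mul, coeff_subst_linearForm]
    set n := ∑ i, I i with hn
    let h : EuclideanSpace ℝ (Fin d) → 𝕜 := fun x =>
      (∏ i, ((x i : ℝ) : 𝕜) ^ I i) * MvPolynomial.eval (fun i => ((x i : ℝ) : 𝕜)) ρ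
    have hh : ∀ (r : ℝ) x, h (r • x) = r ^ (n + δ) • h x := by
      intro r x
      simp only [h]
      rw [eval_real_smul hρ, RCLike.real_smul_eq_coe_mul]
      simp only [PiLp.smul_apply, smul_eq_mul, map_mul, mul_pow, Finset.prod_mul_distrib,
        Finset.prod_pow_eq_pow_sum, ← hn, map_pow, pow_add]
      ring
    -- In the coordinates of the orthant, the integrand is a combination of monomials.
    have hcoord : ∀ (s : ι → ℝ) i, (((∑ j, s j • v j) i : ℝ) : 𝕜) = ∑ j, (s j : 𝕜) * w j i := by
      intro s i
      simp [w]
    have hρR : ∀ s : ι → ℝ, MvPolynomial.eval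
        (fun i => (((∑ j, s j • v j) i : ℝ) : 𝕜)) ρ =
          ∑ α ∈ R.support, R.coeff α * ∏ j, ((s j : ℝ) : 𝕜) ^ α j := by
      intro s
      rw [← MvPolynomial.eval_eq' (fun j => ((s j : ℝ) : 𝕜)) R]
      simp_rw [hcoord]
      simp only [R, MvPolynomial.aeval_def, MvPolynomial.algebraMap_eq]
      rw [MvPolynomial.hom_eval₂, MvPolynomial.eval, MvPolynomial.coe_eval₂Hom]
      congr 1
      · ext1 r; simp
      · ext1 i
        simp [linearForm, mul_comm]
    have hfac : (∏ i, ((I i).factorial : 𝕜)) ≠ 0 :=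
      Finset.prod_ne_zero_iff.2 fun i _ => by exact_mod_cast Nat.factorial_ne_zero _
    have hexpand : ∀ s : ι → ℝ, Real.exp (-∑ j, s j) • h (∑ j, s j • v j) =
        ∑ β ∈ Finset.univ.finsuppAntidiag n, ∑ α ∈ R.support,
          ((∏ i, ((I i).factorial : 𝕜)) * (R.coeff α / (∏ j, ((β j).factorial : 𝕜)) *
            MvPolynomial.coeff I (∏ j, linearForm (w j) ^ β j))) *
          (Real.exp (-∑ j, s j) • ∏ j, ((s j : ℝ) : 𝕜) ^ (α j + β j)) := by
      intro s
      have h1 := prod_pow_div_factorial_eq_sum w (fun j => ((s j : ℝ) : 𝕜)) I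
      rw [div_eq_iff hfac, ← hn] at h1
      simp only [h]
      rw [hρR s]
      simp_rw [hcoord]
      rw [h1, Finset.sum_mul, Finset.sum_mul_sum, Finset.smul_sum]
      refine Finset.sum_congr rfl fun β _ => ?_
      rw [Finset.smul_sum]
      refine Finset.sum_congr rfl fun α _ => ?_
      simp_rw [RCLike.real_smul_eq_coe_mul, pow_add, Finset.prod_mul_distrib]
      ring
    have hterm : ∀ α β : ι →₀ ℕ, IntegrableOn (fun s : ι → ℝ =>
        ((∏ i, ((I i).factorial : 𝕜)) * (R.coeff α / (∏ j, ((β j).factorial : 𝕜)) *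
            MvPolynomial.coeff I (∏ j, linearForm (w j) ^ β j))) *
          (Real.exp (-∑ j, s j) • ∏ j, ((s j : ℝ) : 𝕜) ^ (α j + β j))) (Set.Ici 0) :=
      fun α β => (integrableOn_exp_neg_sum_smul_prod_pow fun j => α j + β j).const_mul _
    have hint : IntegrableOn
        (fun s : ι → ℝ => Real.exp (-∑ j, s j) • h (∑ j, s j • v j)) (Set.Ici 0) := by
      simp_rw [hexpand]
      exact integrable_finsetSum _ fun β _ => integrable_finsetSum _ fun α _ => hterm α β
    have hval := hc (n + δ) h hh hint
    simp_rw [hexpand] at hval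
    rw [integral_finsetSum _ fun β _ => integrable_finsetSum _ fun α _ => hterm α β] at hval
    simp_rw [integral_finsetSum _ fun α _ => hterm α _, integral_const_mul,
      integral_exp_neg_sum_smul_prod_pow, RCLike.real_smul_eq_coe_mul, finrank_euclideanSpace,
      Fintype.card_fin] at hval
    have hcoeff : MvPowerSeries.coeff I
        (momentGenFun δ ρ (standardMeasure (convexHull ℝ (Set.range v)))) =
        ((n + d + δ).factorial : 𝕜) / (∏ i, ((I i).factorial : 𝕜)) *
          ∫ x in convexHull ℝ (Set.range v), h x := rfl
    rw [hcoeff, div_mul_eq_mul_div, div_eq_iff hfac,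
      show n + d + δ = n + δ + d by ring]
    rw [RCLike.ofReal_natCast] at hval
    rw [hval, mul_assoc, Finset.sum_mul]
    congr 1
    refine Finset.sum_congr rfl fun β _ => ?_
    rw [hWcoeff, Finset.sum_mul, Finset.sum_mul]
    refine Finset.sum_congr rfl fun α _ => ?_
    ring
  refine ⟨MvPolynomial.C (c : 𝕜) * MvPolynomial.aeval (fun j => linearForm (w j)) p, ?_⟩
  rw [hF, mul_left_comm, MvPolynomial.coe_mul, MvPolynomial.coe_C, ← hmain]
  rfl

end Simplex
/-! ### Convergence near the origin -/

section Convergence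

variable {𝕜 : Type*} [RCLike 𝕜]

/-- The multinomial theorem bounds the partial sums by those of a geometric series. -/
lemma summable_multinomial_mul_pow {κ : Type*} [Fintype κ] {a : ℝ} (ha : 0 ≤ a)
    (ha1 : Fintype.card κ * a < 1) :
    Summable fun I : κ →₀ ℕ => (Nat.multinomial Finset.univ I : ℝ) * a ^ ∑ i, I i := by
  classical
  have hca : 0 ≤ Fintype.card κ * a := by positivity
  refine summable_of_sum_le (c := (1 - Fintype.card κ * a)⁻¹) (fun I => by positivity) fun s => ?_
  let N := s.sup (fun I => ∑ i, I i) + 1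
  have hmaps : ∀ I ∈ s, ∑ i, I i ∈ Finset.range N := fun I hI =>
    Finset.mem_range.2 (Nat.lt_succ_of_le (Finset.le_sup (f := fun I : κ →₀ ℕ => ∑ i, I i) hI))
  rw [← Finset.sum_fiberwise_of_maps_to hmaps]
  calc _ ≤ ∑ k ∈ Finset.range N, (Fintype.card κ * a) ^ k := by
        refine Finset.sum_le_sum fun k _ => ?_
        have hsub : s.filter (fun I => ∑ i, I i = k) ⊆ Finset.univ.finsuppAntidiag k := by
          intro I hI
          exact Finset.mem_finsuppAntidiag.2 ⟨(Finset.mem_filter.1 hI).2, Finset.subset_univ _⟩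
        refine (Finset.sum_le_sum_of_subset_of_nonneg hsub
          fun _ _ _ => by positivity).trans_eq ?_
        rw [sum_finsuppAntidiag_univ k
          (fun I => (Nat.multinomial Finset.univ I : ℝ) * a ^ ∑ i, I i)]
        have h := Finset.sum_pow_eq_sum_piAntidiag (Finset.univ : Finset κ) (fun _ => a) k
        rw [Finset.sum_const, Finset.card_univ, nsmul_eq_mul] at h
        rw [h]
        exact Finset.sum_congr rfl fun I _ => by rw [Finset.prod_pow_eq_pow_sum]
    _ ≤ ∑' k : ℕ, (Fintype.card κ * a) ^ k :=
        (summable_geometric_of_lt_one hca ha1).sum_le_tsum _ fun k _ => by positivity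
    _ = _ := tsum_geometric_of_lt_one hca ha1

variable {d : ℕ}

lemma exists_norm_moment_le (ρ : MvPolynomial (Fin d) 𝕜) {P : Set (EuclideanSpace ℝ (Fin d))}
    (hP : IsCompact P) :
    ∃ C R : ℝ, 0 ≤ C ∧ 0 ≤ R ∧ ∀ I : Fin d →₀ ℕ,
      ‖moment ρ (standardMeasure P) I‖ ≤ C * R ^ ∑ i, I i := by
  obtain ⟨R, hR⟩ := hP.isBounded.exists_norm_le
  have hcont : Continuous fun x : EuclideanSpace ℝ (Fin d) =>
      MvPolynomial.eval (fun i => ((x i : ℝ) : 𝕜)) ρ :=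
    (MvPolynomial.continuous_eval ρ).comp (by fun_prop)
  obtain ⟨M, hM⟩ := hP.exists_bound_of_continuousOn hcont.continuousOn
  refine ⟨|M| * volume.real P, |R|, by positivity, abs_nonneg R, fun I => ?_⟩
  have hb : ∀ x ∈ P, ‖(∏ i, ((x i : ℝ) : 𝕜) ^ I i) *
      MvPolynomial.eval (fun i => ((x i : ℝ) : 𝕜)) ρ‖ ≤ |R| ^ (∑ i, I i) * |M| := by
    intro x hx
    rw [norm_mul, norm_prod, ← Finset.prod_pow_eq_pow_sum]
    refine mul_le_mul ?_ ((hM x hx).trans (le_abs_self M)) (norm_nonneg _) (by positivity)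
    refine Finset.prod_le_prod (fun _ _ => norm_nonneg _) fun i _ => ?_
    rw [norm_pow, RCLike.norm_ofReal, ← Real.norm_eq_abs]
    exact pow_le_pow_left₀ (norm_nonneg _)
      ((PiLp.norm_apply_le x i).trans ((hR x hx).trans (le_abs_self R))) _
  refine (norm_setIntegral_le_of_norm_le_const hP.measure_lt_top hb).trans_eq ?_
  ring

lemma factorial_add_le (n m : ℕ) :
    ((n + m).factorial : ℝ) ≤ (m.factorial * 2 ^ m) * (n.factorial * 2 ^ n) := by
  have h1 := Nat.add_choose_mul_factorial_mul_factorial n m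
  have h2 := Nat.choose_le_two_pow (n + m) m
  have h3 : (n + m).factorial ≤ 2 ^ (n + m) * n.factorial * m.factorial := by
    rw [← h1]; gcongr
  calc ((n + m).factorial : ℝ) ≤ ((2 ^ (n + m) * n.factorial * m.factorial : ℕ) : ℝ) := by
        exact_mod_cast h3
    _ = _ := by push_cast; ring

theorem eventually_summable_norm_momentGenFun (δ : ℕ) (ρ : MvPolynomial (Fin d) 𝕜)
    {P : Set (EuclideanSpace ℝ (Fin d))} (hP : IsCompact P) :
    ∀ᶠ u : Fin d → 𝕜 in 𝓝 0, Summable fun I : Fin d →₀ ℕ =>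
      ‖MvPowerSeries.coeff I (momentGenFun δ ρ (standardMeasure P)) * ∏ i, u i ^ I i‖ := by
  obtain ⟨C, R, hC, hR, hmom⟩ := exists_norm_moment_le ρ hP
  -- The radius is chosen so that `d * (2 * R * ε) < 1`.
  let ε : ℝ := 1 / (2 * (d + 1) * (R + 1))
  have hε : 0 < ε := by positivity
  have hsmall : (Fintype.card (Fin d)) * (2 * R * ε) < 1 := by
    rw [Fintype.card_fin]
    have : (d : ℝ) * (2 * R * ε) = (d * R) / ((d + 1) * (R + 1)) := by
      simp only [ε]; field_simp
    rw [this, div_lt_one (by positivity)]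
    nlinarith [(Nat.cast_nonneg d : (0 : ℝ) ≤ d)]
  filter_upwards [Metric.ball_mem_nhds (0 : Fin d → 𝕜) hε] with u hu
  have hui : ∀ i, ‖u i‖ ≤ ε := fun i =>
    (norm_le_pi_norm u i).trans (mem_ball_zero_iff.1 hu).le
  refine Summable.of_nonneg_of_le (fun _ => norm_nonneg _) (fun I => ?_)
    ((summable_multinomial_mul_pow (κ := Fin d) (a := 2 * R * ε) (by positivity) hsmall).mul_left
      (((d + δ).factorial * 2 ^ (d + δ)) * C))
  set n := ∑ i, I i with hn
  have hprod : ‖∏ i, u i ^ I i‖ ≤ ε ^ n := by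
    rw [norm_prod, hn, ← Finset.prod_pow_eq_pow_sum]
    refine Finset.prod_le_prod (fun _ _ => norm_nonneg _) fun i _ => ?_
    rw [norm_pow]
    exact pow_le_pow_left₀ (norm_nonneg _) (hui i) _
  have hcoeff : MvPowerSeries.coeff I (momentGenFun δ ρ (standardMeasure P)) =
      ((n + d + δ).factorial : 𝕜) / (∏ i, ((I i).factorial : 𝕜)) *
        moment ρ (standardMeasure P) I := rfl
  have hfac : (0 : ℝ) < ∏ i, ((I i).factorial : ℝ) :=
    Finset.prod_pos fun i _ => by exact_mod_cast Nat.factorial_pos _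
  rw [hcoeff, norm_mul, norm_mul, norm_div, norm_prod]
  simp_rw [RCLike.norm_natCast]
  rw [multinomial_univ_eq_div, ← hn, mul_pow, mul_pow]
  calc _ ≤ ((d + δ).factorial * 2 ^ (d + δ)) * (n.factorial * 2 ^ n) /
          (∏ i, ((I i).factorial : ℝ)) * (C * R ^ n) * ε ^ n := by
        rw [add_assoc]
        gcongr
        · exact factorial_add_le n (d + δ)
        · exact hmom I
    _ = _ := by ring

lemma hasSum_coeff_mul_prod_pow {κ : Type*} [Fintype κ] (r : MvPolynomial κ 𝕜) (u : κ → 𝕜) :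
    HasSum (fun I : κ →₀ ℕ => r.coeff I * ∏ i, u i ^ I i) (MvPolynomial.eval u r) := by
  rw [MvPolynomial.eval_eq']
  exact hasSum_sum_of_ne_finset_zero fun I hI => by
    rw [MvPolynomial.notMem_support_iff.1 hI, zero_mul]

lemma summable_norm_coeff_mul_prod_pow {κ : Type*} [Fintype κ] (r : MvPolynomial κ 𝕜)
    (u : κ → 𝕜) : Summable fun I : κ →₀ ℕ => ‖r.coeff I * ∏ i, u i ^ I i‖ :=
  summable_of_ne_finset_zero (s := r.support) fun I hI => by
    rw [MvPolynomial.notMem_support_iff.1 hI, zero_mul, norm_zero]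

lemma coeff_mul_mul_prod_pow {κ : Type*} [Fintype κ] [DecidableEq κ] (F G : MvPowerSeries κ 𝕜)
    (u : κ → 𝕜) (I : κ →₀ ℕ) :
    MvPowerSeries.coeff I (F * G) * ∏ i, u i ^ I i =
      ∑ kl ∈ Finset.HasAntidiagonal.antidiagonal I,
        (MvPowerSeries.coeff kl.1 F * ∏ i, u i ^ kl.1 i) *
          (MvPowerSeries.coeff kl.2 G * ∏ i, u i ^ kl.2 i) := by
  rw [MvPowerSeries.coeff_mul, Finset.sum_mul]
  refine Finset.sum_congr rfl fun kl hkl => ?_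
  have hI : ∏ i, u i ^ I i = (∏ i, u i ^ kl.1 i) * ∏ i, u i ^ kl.2 i := by
    rw [← Finset.HasAntidiagonal.mem_antidiagonal.1 hkl, ← Finset.prod_mul_distrib]
    exact Finset.prod_congr rfl fun i _ => pow_add _ _ _
  rw [hI, mul_mul_mul_comm]

/-- If `q F = p` formally, then `F` sums to `p / q` wherever it converges absolutely and
`q` does not vanish. -/
lemma hasSum_div_of_coe_mul_eq_coe {κ : Type*} [Fintype κ] {F : MvPowerSeries κ 𝕜}
    {p q : MvPolynomial κ 𝕜} (h : (q : MvPowerSeries κ 𝕜) * F = p) {u : κ → 𝕜}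
    (hF : Summable fun I : κ →₀ ℕ => ‖MvPowerSeries.coeff I F * ∏ i, u i ^ I i‖)
    (hq : MvPolynomial.eval u q ≠ 0) :
    HasSum (fun I : κ →₀ ℕ => MvPowerSeries.coeff I F * ∏ i, u i ^ I i)
      (MvPolynomial.eval u p / MvPolynomial.eval u q) := by
  classical
  let f : (κ →₀ ℕ) → 𝕜 := fun I => q.coeff I * ∏ i, u i ^ I i
  let g : (κ →₀ ℕ) → 𝕜 := fun I => MvPowerSeries.coeff I F * ∏ i, u i ^ I i
  have hf : HasSum f (MvPolynomial.eval u q) := hasSum_coeff_mul_prod_pow q u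
  have hg : Summable g := hF.of_norm
  have hfg : Summable fun x : (κ →₀ ℕ) × (κ →₀ ℕ) => f x.1 * g x.2 :=
    summable_mul_of_summable_norm (summable_norm_coeff_mul_prod_pow q u) hF
  have hcauchy := hf.summable.tsum_mul_tsum_eq_tsum_sum_antidiagonal hg hfg
  have hinner : ∀ I : κ →₀ ℕ, ∑ kl ∈ Finset.HasAntidiagonal.antidiagonal I,
      f kl.1 * g kl.2 = p.coeff I * ∏ i, u i ^ I i := fun I => by
    rw [← MvPolynomial.coeff_coe p, ← h, coeff_mul_mul_prod_pow]
    simp only [MvPolynomial.coeff_coe, f, g]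
  rw [tsum_congr hinner, hf.tsum_eq,
    (hasSum_coeff_mul_prod_pow p u).tsum_eq] at hcauchy
  rw [← hcauchy, mul_div_cancel_left₀ _ hq]
  exact hg.hasSum

end Convergence

/-! ### Rationality of the moment generating function of a polytope -/

section Polytope

variable {𝕜 : Type*} [RCLike 𝕜] {d : ℕ}

theorem exists_dualForm_mul_momentGenFun (V : Finset (EuclideanSpace ℝ (Fin d))) (δ : ℕ)
    (ρ : MvPolynomial (Fin d) 𝕜) (hρ : ρ.IsHomogeneous δ) :
    ∃ p : MvPolynomial (Fin d) 𝕜,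
      ((∏ v ∈ V, dualForm 𝕜 v ^ (δ + 1) : MvPolynomial (Fin d) 𝕜) : MvPowerSeries (Fin d) 𝕜) *
        momentGenFun δ ρ (standardMeasure
          (convexHull ℝ (V : Set (EuclideanSpace ℝ (Fin d))))) = p := by
  classical
  obtain ⟨T, hT, hint⟩ := exists_triangulation
    (volume : Measure (EuclideanSpace ℝ (Fin d))) V
  have hF : momentGenFun δ ρ (standardMeasure
      (convexHull ℝ (V : Set (EuclideanSpace ℝ (Fin d))))) = ∑ σ ∈ T,
        momentGenFun δ ρ (standardMeasure
          (convexHull ℝ (σ : Set (EuclideanSpace ℝ (Fin d))))) := by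
    ext I
    have hcoeff : ∀ Ω : Set (EuclideanSpace ℝ (Fin d)), MvPowerSeries.coeff I
        (momentGenFun δ ρ (standardMeasure Ω)) =
          (((∑ i, I i) + d + δ).factorial : 𝕜) / (∏ i, ((I i).factorial : 𝕜)) *
            moment ρ (standardMeasure Ω) I := fun _ => rfl
    simp_rw [map_sum, hcoeff, ← Finset.mul_sum]
    congr 1
    refine hint _ ?_
    have : Continuous fun x : EuclideanSpace ℝ (Fin d) =>
        MvPolynomial.eval (fun i => ((x i : ℝ) : 𝕜)) ρ :=
      (MvPolynomial.continuous_eval ρ).comp (by fun_prop)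
    fun_prop
  -- The vertices of a cell lie in `V`, so its denominator divides the product over `V`.
  have hσ : ∀ σ : Finset (EuclideanSpace ℝ (Fin d)), ∃ p : MvPolynomial (Fin d) 𝕜, σ ∈ T →
      ((∏ v ∈ V, dualForm 𝕜 v ^ (δ + 1) : MvPolynomial (Fin d) 𝕜) : MvPowerSeries (Fin d) 𝕜) *
        momentGenFun δ ρ (standardMeasure
          (convexHull ℝ (σ : Set (EuclideanSpace ℝ (Fin d))))) = p := by
    intro σ
    by_cases hσT : σ ∈ T
    · obtain ⟨hσV, hind, htop⟩ := hT σ hσT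
      have hcard : Fintype.card σ = d + 1 := by
        rw [hind.affineSpan_eq_top_iff_card_eq_finrank_add_one.1 (by simpa using htop)]
        simp
      obtain ⟨p, hp⟩ := exists_dualForm_mul_momentGenFun_simplex hind hcard δ ρ hρ
      have hrange : Set.range ((↑) : σ → EuclideanSpace ℝ (Fin d)) = σ := by simp
      rw [hrange, Finset.prod_coe_sort σ fun v => dualForm 𝕜 v ^ (δ + 1)] at hp
      refine ⟨(∏ v ∈ V \ σ, dualForm 𝕜 v ^ (δ + 1)) * p, fun _ => ?_⟩
      rw [← Finset.prod_sdiff hσV, MvPolynomial.coe_mul, MvPolynomial.coe_mul, mul_assoc, hp]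
    · exact ⟨0, fun h => absurd h hσT⟩
  choose p hp using hσ
  refine ⟨∑ σ ∈ T, p σ, ?_⟩
  rw [hF, Finset.mul_sum, ← MvPolynomial.coeToMvPowerSeries.ringHom_apply (∑ σ ∈ T, p σ), map_sum]
  exact Finset.sum_congr rfl fun σ hσ => hp σ hσ

lemma eval_zero_prod_dualForm (V : Finset (EuclideanSpace ℝ (Fin d))) (m : ℕ) :
    MvPolynomial.eval 0 (∏ v ∈ V, dualForm 𝕜 v ^ m) = 1 := by
  simp [map_prod, dualForm]

end Polytope
end PolytopeMoments

theorem corollary1p4 {𝕜 : Type*} [RCLike 𝕜] {d : ℕ}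
    (P : Set (EuclideanSpace ℝ (Fin d))) (hP : PolytopeMoments.IsConvexPolytope P)
    (V : Finset (EuclideanSpace ℝ (Fin d))) (hV : PolytopeMoments.IsVertexSet P V)
    (δ : ℕ) (ρ : MvPolynomial (Fin d) 𝕜) (hρ : ρ.IsHomogeneous δ) :
    ∃ p q : MvPolynomial (Fin d) 𝕜,
      IsRelPrime p q ∧
      q ∣ ∏ v ∈ V, PolytopeMoments.dualForm 𝕜 v ^ (δ + 1) ∧
      (q : MvPowerSeries (Fin d) 𝕜) *
          PolytopeMoments.momentGenFun δ ρ (PolytopeMoments.standardMeasure P) =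
        (p : MvPowerSeries (Fin d) 𝕜) ∧
      ∀ᶠ u : Fin d → 𝕜 in 𝓝 0,
        MvPolynomial.eval u q ≠ 0 ∧
        HasSum
          (fun I : Fin d →₀ ℕ =>
            MvPowerSeries.coeff I
              (PolytopeMoments.momentGenFun δ ρ (PolytopeMoments.standardMeasure P)) *
              ∏ i, u i ^ I i)
          (MvPolynomial.eval u p / MvPolynomial.eval u q) := by
  have hVP : convexHull ℝ (V : Set (EuclideanSpace ℝ (Fin d))) = P := hV.prop
  have hcompact : IsCompact P := hVP ▸ V.finite_toSet.isCompact_convexHull ℝ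
  obtain ⟨N, hN⟩ := PolytopeMoments.exists_dualForm_mul_momentGenFun V δ ρ hρ
  rw [hVP] at hN
  set D : MvPolynomial (Fin d) 𝕜 := ∏ v ∈ V, PolytopeMoments.dualForm 𝕜 v ^ (δ + 1) with hD
  have hD0 : MvPolynomial.eval 0 D = 1 := PolytopeMoments.eval_zero_prod_dualForm V (δ + 1)
  have hDne : D ≠ 0 := fun h => by simp [h] at hD0
  obtain ⟨q, p, c, hrel, hcq, hcp⟩ := UniqueFactorizationMonoid.exists_reduced_factors D hDne N
  have hc : (c : MvPowerSeries (Fin d) 𝕜) ≠ 0 := fun h =>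
    hDne (by rw [← hcq, MvPolynomial.coe_eq_zero_iff.1 h, zero_mul])
  have hqF : (q : MvPowerSeries (Fin d) 𝕜) *
      PolytopeMoments.momentGenFun δ ρ (PolytopeMoments.standardMeasure P) = p := by
    rw [← hcq, ← hcp, MvPolynomial.coe_mul, MvPolynomial.coe_mul, mul_assoc] at hN
    exact mul_left_cancel₀ hc hN
  have hq0 : MvPolynomial.eval 0 q ≠ 0 := by
    intro h
    rw [← hcq, map_mul, h, mul_zero] at hD0
    exact zero_ne_one hD0
  refine ⟨p, q, hrel.symm, ⟨c, by rw [← hcq, mul_comm]⟩, hqF, ?_⟩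
  have hqev : ∀ᶠ u : Fin d → 𝕜 in 𝓝 0, MvPolynomial.eval u q ≠ 0 :=
    (MvPolynomial.continuous_eval q).continuousAt.eventually_ne hq0
  filter_upwards [hqev,
    PolytopeMoments.eventually_summable_norm_momentGenFun δ ρ hcompact] with u hu hsum
  exact ⟨hu, PolytopeMoments.hasSum_div_of_coe_mul_eq_coe hqF hsum hu⟩
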